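/- Let $\alpha,\nu\in\mathbb{R}$ with $\alpha>-1$ and $\alpha+\nu>-1$, and let $K_\mu(x)=\int_0^\infty e^{-x\cosh t}\cosh(\mu t)\,dt$ $(x>0)$ be the modified Bessel function of the second kind. For $n,m\ge 0$, a multiple orthogonal polynomial with multi-index $(n,m)$ is a monic real polynomial $P_{n,m}$ of degree $n+m$ such that $$\int_0^\infty x^kP_{n,m}(x)\,x^{\alpha+\nu/2}K_\nu(2\sqrt{x})\,dx=0\quad(0\le k\le n-1),$$ $$\int_0^\infty x^kP_{n,m}(x)\,x^{\alpha+(\nu+1)/2}K_{\nu+1}(2\sqrt{x})\,dx=0\quad(0\le k\le m-1).$$ Then for every $n\ge 0$ the polynomials $P_{n,n}$ and $P_{n+1,n}$ exist and are unique. Set $p_{2n}=P_{n,n}$ and $p_{2n+1}=P_{n+1,n}$. Then $$\lim_{n\to\infty}(-1)^n\,\frac{p_n(z/n)}{(\alpha+1)_n(\alpha+\nu+1)_n}={}_0F_2(-;\alpha+1,\alpha+\nu+1;-z)=\sum_{k=0}^\infty\frac{(-z)^k}{(\alpha+1)_k(\alpha+\nu+1)_k\,k!},$$ uniformly for $z$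 in compact subsets of $\mathbb{C}$, where $(a)_k=a(a+1)\cdots(a+k-1)$ and $(a)_0=1$. -/

import Mathlib

/-- The modified Bessel function of the second kind (Macdonald function) of real order `ν` at a
positive real argument `x`: `K_ν(x) = ∫_0^∞ exp(-x cosh t) cosh(ν t) dt`. -/
noncomputable def besselK (ν x : ℝ) : ℝ :=
  ∫ t in Set.Ioi (0 : ℝ), Real.exp (-x * Real.cosh t) * Real.cosh (ν * t)

/-- The weight `x^(α + ν/2) K_ν(2 √x)` on `(0, ∞)`. -/
noncomputable def besselKWeight (α ν x : ℝ) : ℝ :=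
  x ^ (α + ν / 2) * besselK ν (2 * Real.sqrt x)

/-- `P` is the (monic, type II) multiple orthogonal polynomial with multi-index `(n, m)` for the
two weights `x^(α + ν/2) K_ν(2 √x)` and `x^(α + (ν+1)/2) K_(ν+1)(2 √x)` on `(0, ∞)`. -/
structure IsBesselKMOP (α ν : ℝ) (n m : ℕ) (P : Polynomial ℝ) : Prop where
  monic : P.Monic
  natDegree_eq : P.natDegree = n + m
  orthogonal_left : ∀ k < n,
    ∫ x in Set.Ioi (0 : ℝ), x ^ k * P.eval x * besselKWeight α ν x = 0
  orthogonal_right : ∀ k < m,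
    ∫ x in Set.Ioi (0 : ℝ), x ^ k * P.eval x * besselKWeight α (ν + 1) x = 0

/-- The Pochhammer symbol `(a)_n = a (a+1) ⋯ (a+n-1)`. -/
noncomputable def pochhammerSymbol (a : ℂ) (n : ℕ) : ℂ :=
  (ascPochhammer ℂ n).eval a

/-- The generalized hypergeometric function `₀F₂(-; a, b; z)`, where `a`, `b` are not in
`{0, -1, -2, …}`; the series then converges for every `z`. -/
noncomputable def hypergeometric0F2 (a b z : ℂ) : ℂ :=
  ∑' k : ℕ, z ^ k / (pochhammerSymbol a k * pochhammerSymbol b k * (Nat.factorial k : ℂ))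

/-! The Mellin transform of `x ^ (ν / 2) K_ν(2 √x)` at `s` is `Γ(s) Γ(s + ν) / 2`
(`besselK_mellin`), because `2 x ^ (ν / 2) K_ν(2 √x) = ∫ v ^ (ν - 1) exp (-v - x / v) dv` over
`(0, ∞)` (`integral_eq_besselK`) and the integrals in `x` and `v` may be exchanged. Write
`a = α + 1`, `b = α + ν + 1` and `M_j = Γ(a + j) Γ(b + j)`. The `k`-th moments of the two weights are
then `Γ(a + k) Γ(b + k) / 2` and `Γ(a + k) Γ(b + k + 1) / 2`.

For a polynomial `∑ c_j x ^ j` of degree `N`, orthogonality to `x ^ k` for the two weights therefore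
reads `∑ c_j M_j q(j) = 0` with `q(j) = (a + j)_k (b + j)_k` and `q(j) = (a + j)_k (b + j)_(k+1)`
respectively. These polynomials `q` have degrees `2k` and `2k + 1`, so for the multi-indices `(n, n)`
and `(n + 1, n)` they form a basis of the polynomials of degree `< N` (`isBesselKMOP_iff`). The
sequences on `{0, …, N}` orthogonal to that space are the multiples of `(-1) ^ j (N choose j)`. This
gives existence, uniqueness and the formula
`c_j = (-1) ^ (N - j) (N choose j) M_N / M_j` (`isBesselKMOP_iff_coeff`).

After the rescaling the `j`-th term of the polynomial is the `j`-th term of the `₀F₂` series times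
`N (N-1) ⋯ (N-j+1) / N ^ j` (`rescaled_isBesselKMOP_eq_tsum`). These factors lie in `[0, 1]` and tend
to `1`, so dominated convergence gives uniform convergence on every disc. -/

/-! ### Moments of the Bessel weights -/

section

open MeasureTheory

/-- The kernel `x ^ (s - 1) v ^ (ν - 1) exp (-v - x / v)` is integrable on the quadrant, and
integrating first in `x` gives `Γ(s) v ^ (s + ν - 1) exp (-v)`, hence the value `Γ(s) Γ(s + ν)`. -/
theorem integrable_macdonaldKernel {s ν : ℝ} (hs : 0 < s) (hsν : 0 < s + ν) :
    Integrable (Function.uncurry fun x v : ℝ => x ^ (s - 1) * (v ^ (ν - 1) * Real.exp (-v - x / v)))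
      ((volume.restrict (Set.Ioi 0)).prod (volume.restrict (Set.Ioi 0))) ∧
    ∫ x in Set.Ioi (0 : ℝ), x ^ (s - 1) * ∫ v in Set.Ioi (0 : ℝ), v ^ (ν - 1) * Real.exp (-v - x / v)
      = Real.Gamma s * Real.Gamma (s + ν) := by
  have split : ∀ x v : ℝ, x ^ (s - 1) * (v ^ (ν - 1) * Real.exp (-v - x / v)) =
      (v ^ (ν - 1) * Real.exp (-v)) * (x ^ (s - 1) * Real.exp (-(v⁻¹ * x))) := by
    intro x v
    rw [show -v - x / v = -v + -(v⁻¹ * x) by ring, Real.exp_add]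
    ring
  have inner : ∀ v ∈ Set.Ioi (0 : ℝ),
      ∫ x in Set.Ioi (0 : ℝ), x ^ (s - 1) * (v ^ (ν - 1) * Real.exp (-v - x / v)) =
        Real.Gamma s * (Real.exp (-v) * v ^ (s + ν - 1)) := by
    intro v hv
    have hv : 0 < v := hv
    simp_rw [split]
    rw [integral_const_mul, Real.integral_rpow_mul_exp_neg_mul_Ioi hs (inv_pos.2 hv),
      one_div, inv_inv, show s + ν - 1 = (ν - 1) + s by ring, Real.rpow_add hv]
    ring
  have hint : Integrable
      (Function.uncurry fun x v : ℝ => x ^ (s - 1) * (v ^ (ν - 1) * Real.exp (-v - x / v)))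
      ((volume.restrict (Set.Ioi 0)).prod (volume.restrict (Set.Ioi 0))) := by
    rw [integrable_prod_iff']
    · constructor
      · filter_upwards [ae_restrict_mem measurableSet_Ioi] with v hv
        simp only [Function.uncurry_apply_pair, split]
        have h := integrableOn_rpow_mul_exp_neg_mul_rpow (p := 1) (s := s - 1) (by linarith)
          one_pos (inv_pos.2 (show (0 : ℝ) < v from hv))
        simp only [Real.rpow_one, neg_mul] at h
        exact Integrable.const_mul h _
      · refine (IntegrableOn.congr_fun ((Real.GammaIntegral_convergent hsν).const_mul
          (Real.Gamma s)) ?_ measurableSet_Ioi)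
        intro v hv
        refine (inner v hv).symm.trans ?_
        refine setIntegral_congr_fun measurableSet_Ioi fun x hx => ?_
        have hx : 0 < x := hx
        have hv : 0 < v := hv
        simp only [Function.uncurry_apply_pair]
        rw [Real.norm_of_nonneg (by positivity)]
    · apply Measurable.aestronglyMeasurable
      unfold Function.uncurry
      fun_prop
  refine ⟨hint, ?_⟩
  calc _ = ∫ x in Set.Ioi (0 : ℝ), ∫ v in Set.Ioi (0 : ℝ),
        x ^ (s - 1) * (v ^ (ν - 1) * Real.exp (-v - x / v)) := by
        simp_rw [integral_const_mul]
    _ = ∫ v in Set.Ioi (0 : ℝ), ∫ x in Set.Ioi (0 : ℝ),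
        x ^ (s - 1) * (v ^ (ν - 1) * Real.exp (-v - x / v)) := integral_integral_swap hint
    _ = ∫ v in Set.Ioi (0 : ℝ), Real.Gamma s * (Real.exp (-v) * v ^ (s + ν - 1)) :=
        setIntegral_congr_fun measurableSet_Ioi inner
    _ = _ := by rw [integral_const_mul, Real.Gamma_eq_integral hsν]

/-- The substitution `v = √x exp t` turns the integral into one over `ℝ` with integrand
`x ^ (ν / 2) exp (-2 √x cosh t) exp (ν t)`, whose even part gives the Macdonald function. -/
theorem integral_eq_besselK {ν x : ℝ} (hx : 0 < x)
    (hint : IntegrableOn (fun v : ℝ => v ^ (ν - 1) * Real.exp (-v - x / v)) (Set.Ioi 0)) :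
    ∫ v in Set.Ioi (0 : ℝ), v ^ (ν - 1) * Real.exp (-v - x / v) =
      2 * (x ^ (ν / 2) * besselK ν (2 * √x)) := by
  have hr : 0 < √x := Real.sqrt_pos.2 hx
  have himg : (fun t : ℝ => √x * Real.exp t) '' Set.univ = Set.Ioi 0 := by
    ext v
    simp only [Set.image_univ, Set.mem_range, Set.mem_Ioi]
    constructor
    · rintro ⟨t, rfl⟩
      positivity
    · intro hv
      exact ⟨Real.log (v / √x), by rw [Real.exp_log (by positivity)]; field_simp⟩
  have hder : ∀ t ∈ (Set.univ : Set ℝ),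
      HasDerivWithinAt (fun t : ℝ => √x * Real.exp t) (√x * Real.exp t) Set.univ t :=
    fun t _ => ((Real.hasDerivAt_exp t).const_mul _).hasDerivWithinAt
  have hinj : Set.InjOn (fun t : ℝ => √x * Real.exp t) Set.univ := by
    intro t _ u _ h
    exact Real.exp_injective (mul_left_cancel₀ hr.ne' h)
  have hsub : ∀ t : ℝ, |√x * Real.exp t| • ((√x * Real.exp t) ^ (ν - 1) *
      Real.exp (-(√x * Real.exp t) - x / (√x * Real.exp t))) =
      x ^ (ν / 2) * (Real.exp (-(2 * √x) * Real.cosh t) * Real.exp (ν * t)) := by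
    intro t
    have h1 : x / (√x * Real.exp t) = √x * Real.exp (-t) := by
      rw [Real.exp_neg]
      field_simp
      rw [Real.sq_sqrt hx.le]
    have h2 : (√x * Real.exp t) * (√x * Real.exp t) ^ (ν - 1) = x ^ (ν / 2) * Real.exp (ν * t) := by
      rw [Real.rpow_sub_one (by positivity), mul_div_cancel₀ _ (by positivity),
        Real.mul_rpow hr.le (Real.exp_pos _).le, Real.sqrt_eq_rpow, ← Real.rpow_mul hx.le,
        ← Real.exp_mul]
      ring_nf
    rw [abs_of_pos (by positivity), smul_eq_mul, ← mul_assoc, h2, h1, Real.cosh_eq]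
    ring_nf
  rw [← himg, integrableOn_image_iff_integrableOn_abs_deriv_smul MeasurableSet.univ hder hinj] at hint
  rw [← himg, integral_image_eq_integral_abs_deriv_smul MeasurableSet.univ hder hinj]
  simp_rw [hsub] at hint ⊢
  rw [Measure.restrict_univ, integral_const_mul]
  have hint' : Integrable (fun t : ℝ => Real.exp (-(2 * √x) * Real.cosh t) * Real.exp (ν * t)) := by
    rw [integrableOn_univ] at hint
    exact (integrable_const_mul_iff (Ne.isUnit (by positivity)) _).1 hint
  rw [← setIntegral_univ, ← Set.Iic_union_Ioi (a := (0 : ℝ)),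
    setIntegral_union (Set.Iic_disjoint_Ioi le_rfl) measurableSet_Ioi hint'.integrableOn
      hint'.integrableOn]
  have hneg := integral_comp_neg_Ioi 0
    (fun t : ℝ => Real.exp (-(2 * √x) * Real.cosh t) * Real.exp (ν * t))
  rw [neg_zero] at hneg
  rw [← hneg, ← integral_add hint'.comp_neg.integrableOn hint'.integrableOn, besselK,
    mul_left_comm, ← integral_const_mul (2 : ℝ)]
  congr 1
  refine integral_congr_ae (Filter.Eventually.of_forall fun t => ?_)
  simp only [Real.cosh_neg, Real.cosh_eq (ν * t)]
  ring_nf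

/-- The Mellin transform of `x ^ (ν / 2) K_ν(2 √x)`. -/
theorem besselK_mellin {s ν : ℝ} (hs : 0 < s) (hsν : 0 < s + ν) :
    IntegrableOn (fun x : ℝ => x ^ (s - 1) * (x ^ (ν / 2) * besselK ν (2 * √x))) (Set.Ioi 0) ∧
    ∫ x in Set.Ioi (0 : ℝ), x ^ (s - 1) * (x ^ (ν / 2) * besselK ν (2 * √x)) =
      Real.Gamma s * Real.Gamma (s + ν) / 2 := by
  obtain ⟨hint, hval⟩ := integrable_macdonaldKernel hs hsν
  -- Fubini gives convergence of the `v`-integral for almost every `x`, which is all that is needed.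
  have hae : ∀ᵐ x ∂(volume.restrict (Set.Ioi (0 : ℝ))),
      x ^ (s - 1) * ∫ v in Set.Ioi (0 : ℝ), v ^ (ν - 1) * Real.exp (-v - x / v) =
        2 * (x ^ (s - 1) * (x ^ (ν / 2) * besselK ν (2 * √x))) := by
    filter_upwards [ae_restrict_mem measurableSet_Ioi, hint.prod_right_ae] with x hx hi
    have hx : 0 < x := hx
    rw [integral_eq_besselK hx]
    · ring
    · exact (integrable_const_mul_iff
        (Ne.isUnit (show x ^ (s - 1) ≠ 0 by positivity)) _).1 hi
  have hI := hint.integral_prod_left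
  simp only [Function.uncurry_apply_pair, integral_const_mul] at hI
  rw [integral_congr_ae hae, integral_const_mul] at hval
  exact ⟨(integrable_const_mul_iff (Ne.isUnit two_ne_zero) _).1 (hI.congr hae), by linarith⟩

theorem besselKWeight_moment {α ν : ℝ} (hα : -1 < α) (hαν : -1 < α + ν) (k : ℕ) :
    IntegrableOn (fun x : ℝ => x ^ k * besselKWeight α ν x) (Set.Ioi 0) ∧
    ∫ x in Set.Ioi (0 : ℝ), x ^ k * besselKWeight α ν x =
      Real.Gamma (α + 1 + k) * Real.Gamma (α + ν + 1 + k) / 2 := by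
  have hk : (0 : ℝ) ≤ k := k.cast_nonneg
  have h := besselK_mellin (s := α + 1 + k) (ν := ν) (by linarith) (by linarith)
  have heq : ∀ x ∈ Set.Ioi (0 : ℝ),
      x ^ (α + 1 + k - 1) * (x ^ (ν / 2) * besselK ν (2 * √x)) = x ^ k * besselKWeight α ν x := by
    intro x hx
    have hx : 0 < x := hx
    rw [besselKWeight, show α + 1 + k - 1 = k + α by ring, Real.rpow_add hx, Real.rpow_add hx,
      Real.rpow_natCast]
    ring
  refine ⟨h.1.congr_fun heq measurableSet_Ioi, ?_⟩
  rw [← setIntegral_congr_fun measurableSet_Ioi heq, h.2]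
  ring_nf

/-- The orthogonality integrals in terms of the moments; the integrability of each term is part of
`besselKWeight_moment`. -/
theorem integral_eval_mul_besselKWeight {α ν : ℝ} (hα : -1 < α) (hαν : -1 < α + ν)
    (P : Polynomial ℝ) (k : ℕ) :
    ∫ x in Set.Ioi (0 : ℝ), x ^ k * P.eval x * besselKWeight α ν x =
      ∑ j ∈ Finset.range (P.natDegree + 1), P.coeff j *
        (Real.Gamma (α + 1 + (k + j : ℕ)) * Real.Gamma (α + ν + 1 + (k + j : ℕ)) / 2) := by
  have hexp : ∀ x : ℝ, x ^ k * P.eval x * besselKWeight α ν x =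
      ∑ j ∈ Finset.range (P.natDegree + 1),
        P.coeff j * (x ^ (k + j) * besselKWeight α ν x) := by
    intro x
    rw [Polynomial.eval_eq_sum_range, Finset.mul_sum, Finset.sum_mul]
    exact Finset.sum_congr rfl fun j _ => by ring
  simp_rw [hexp]
  rw [integral_finsetSum _ fun j _ => (besselKWeight_moment hα hαν (k + j)).1.const_mul _]
  exact Finset.sum_congr rfl fun j _ => by
    rw [integral_const_mul, (besselKWeight_moment hα hαν (k + j)).2]

end

/-! ### Orthogonality as a system of equations for the coefficients -/

/-- The monic polynomial `(X + a)_k (X + b)_k` for `i = 2k` and `(X + a)_k (X + b)_(k+1)` for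
`i = 2k + 1`, of degree `i`. Multiplication by its value at `j` takes the `j`-th moment
`Γ(a + j) Γ(b + j)` of the first weight (up to the factor `1 / 2`) to the `(j + k)`-th moment of the
first, respectively the second, weight. -/
noncomputable def shiftedPochhammerPair (a b : ℝ) (i : ℕ) : Polynomial ℝ :=
  (ascPochhammer ℝ (i / 2)).comp (Polynomial.X + Polynomial.C a) *
    (ascPochhammer ℝ ((i + 1) / 2)).comp (Polynomial.X + Polynomial.C b)

theorem shiftedPochhammerPair_monic (a b : ℝ) (i : ℕ) : (shiftedPochhammerPair a b i).Monic :=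
  ((monic_ascPochhammer ℝ _).comp_X_add_C a).mul ((monic_ascPochhammer ℝ _).comp_X_add_C b)

theorem shiftedPochhammerPair_natDegree (a b : ℝ) (i : ℕ) :
    (shiftedPochhammerPair a b i).natDegree = i := by
  rw [shiftedPochhammerPair, ((monic_ascPochhammer ℝ _).comp_X_add_C a).natDegree_mul
    ((monic_ascPochhammer ℝ _).comp_X_add_C b)]
  simp only [Polynomial.natDegree_comp, ascPochhammer_natDegree, Polynomial.natDegree_X_add_C]
  omega

open Polynomial in
/-- A linear map on polynomials of degree `< N` is determined by its values on a family with one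
monic member in each degree. -/
theorem linearMap_eq_zero_of_monic_family {M : Type*} [AddCommGroup M] [Module ℝ M]
    (L : ℝ[X] →ₗ[ℝ] M) {S : ℕ → ℝ[X]} (hmonic : ∀ i, (S i).Monic)
    (hdeg : ∀ i, (S i).natDegree = i) {N : ℕ} (hL : ∀ i < N, L (S i) = 0) {q : ℝ[X]}
    (hq : q.degree < N) : L q = 0 := by
  let T : Polynomial.Sequence ℝ :=
    ⟨S, fun i => by rw [degree_eq_natDegree (hmonic i).ne_zero, hdeg]⟩
  have hspan := T.span_degreeLT (m := N) fun i _ => by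
    change IsUnit (S i).leadingCoeff
    rw [(hmonic i).leadingCoeff]
    exact isUnit_one
  have hmem : q ∈ degreeLT ℝ N := mem_degreeLT.2 hq
  rw [← hspan] at hmem
  refine (Submodule.span_le (p := LinearMap.ker L)).2 ?_ hmem
  rintro _ ⟨i, hi, rfl⟩
  exact hL i hi

theorem Gamma_add_nat {x : ℝ} (hx : 0 < x) (k : ℕ) :
    Real.Gamma (x + k) = (ascPochhammer ℝ k).eval x * Real.Gamma x := by
  induction k with
  | zero => simp
  | succ k ih =>
    rw [Nat.cast_succ, ← add_assoc, Real.Gamma_add_one (by positivity), ih, ascPochhammer_succ_eval]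
    ring

theorem Gamma_mul_Gamma_mul_eval_shiftedPochhammerPair {a b : ℝ} (ha : 0 < a) (hb : 0 < b)
    (i j : ℕ) :
    Real.Gamma (a + j) * Real.Gamma (b + j) * (shiftedPochhammerPair a b i).eval (j : ℝ) =
      Real.Gamma (a + j + (i / 2 : ℕ)) * Real.Gamma (b + j + ((i + 1) / 2 : ℕ)) := by
  rw [Gamma_add_nat (x := a + j) (by positivity), Gamma_add_nat (x := b + j) (by positivity)]
  simp only [shiftedPochhammerPair, Polynomial.eval_mul, Polynomial.eval_comp,
    Polynomial.eval_add, Polynomial.eval_X, Polynomial.eval_C, add_comm a, add_comm b]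
  ring

/-- For the multi-indices `(n, n)` and `(n + 1, n)`, written uniformly as `((N + 1) / 2, N / 2)`, the
orthogonality conditions are tests of the sequence `c_j M_j` against one monic polynomial in each
degree below `N`, hence against all polynomials of degree below `N`. Here `c_j` is the `j`-th
coefficient of `P` and `M_j = Γ(α + 1 + j) Γ(α + ν + 1 + j)`. -/
theorem isBesselKMOP_iff {α ν : ℝ} (hα : -1 < α) (hαν : -1 < α + ν) (N : ℕ)
    (P : Polynomial ℝ) :
    IsBesselKMOP α ν ((N + 1) / 2) (N / 2) P ↔ P.Monic ∧ P.natDegree = N ∧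
      ∀ q : Polynomial ℝ, q.degree < N → ∑ j ∈ Finset.range (N + 1),
        P.coeff j * (Real.Gamma (α + 1 + j) * Real.Gamma (α + ν + 1 + j)) * q.eval (j : ℝ) = 0 := by
  have ha : 0 < α + 1 := by linarith
  have hb : 0 < α + ν + 1 := by linarith
  have heven : ∀ k : ℕ, P.natDegree = N →
      ∫ x in Set.Ioi (0 : ℝ), x ^ k * P.eval x * besselKWeight α ν x =
      (∑ j ∈ Finset.range (N + 1), P.coeff j * (Real.Gamma (α + 1 + j) *
        Real.Gamma (α + ν + 1 + j)) *
          (shiftedPochhammerPair (α + 1) (α + ν + 1) (2 * k)).eval (j : ℝ)) / 2 := by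
    intro k hN
    rw [integral_eval_mul_besselKWeight hα hαν, hN, Finset.sum_div]
    refine Finset.sum_congr rfl fun j _ => ?_
    rw [mul_assoc, Gamma_mul_Gamma_mul_eval_shiftedPochhammerPair ha hb,
      show 2 * k / 2 = k by omega, show (2 * k + 1) / 2 = k by omega]
    push_cast
    ring_nf
  have hodd : ∀ k : ℕ, P.natDegree = N →
      ∫ x in Set.Ioi (0 : ℝ), x ^ k * P.eval x * besselKWeight α (ν + 1) x =
      (∑ j ∈ Finset.range (N + 1), P.coeff j * (Real.Gamma (α + 1 + j) *
        Real.Gamma (α + ν + 1 + j)) *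
          (shiftedPochhammerPair (α + 1) (α + ν + 1) (2 * k + 1)).eval (j : ℝ)) / 2 := by
    intro k hN
    rw [integral_eval_mul_besselKWeight hα (by linarith), hN, Finset.sum_div]
    refine Finset.sum_congr rfl fun j _ => ?_
    rw [mul_assoc, Gamma_mul_Gamma_mul_eval_shiftedPochhammerPair ha hb,
      show (2 * k + 1) / 2 = k by omega, show (2 * k + 1 + 1) / 2 = k + 1 by omega]
    push_cast
    ring_nf
  constructor
  · rintro ⟨hmonic, hdeg, hleft, hright⟩
    have hN : P.natDegree = N := by omega
    refine ⟨hmonic, hN, fun q hq => ?_⟩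
    let L : Polynomial ℝ →ₗ[ℝ] ℝ := ∑ j ∈ Finset.range (N + 1),
      (P.coeff j * (Real.Gamma (α + 1 + j) * Real.Gamma (α + ν + 1 + j))) •
        Polynomial.leval (j : ℝ)
    have hL : ∀ q, L q = ∑ j ∈ Finset.range (N + 1),
        P.coeff j * (Real.Gamma (α + 1 + j) * Real.Gamma (α + ν + 1 + j)) * q.eval (j : ℝ) := by
      intro q
      simp [L, LinearMap.sum_apply, Polynomial.leval_apply]
    rw [← hL]
    refine linearMap_eq_zero_of_monic_family L
      (shiftedPochhammerPair_monic (α + 1) (α + ν + 1))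
      (shiftedPochhammerPair_natDegree (α + 1) (α + ν + 1)) (fun i hi => ?_) hq
    rw [hL]
    obtain ⟨k, rfl | rfl⟩ := Nat.even_or_odd' i
    · have h := hleft k (by omega)
      rw [heven k hN] at h
      linarith
    · have h := hright k (by omega)
      rw [hodd k hN] at h
      linarith
  · rintro ⟨hmonic, hN, hq⟩
    have hS : ∀ i < N, (shiftedPochhammerPair (α + 1) (α + ν + 1) i).degree < N := by
      intro i hi
      rw [Polynomial.degree_eq_natDegree (shiftedPochhammerPair_monic _ _ _).ne_zero,
        shiftedPochhammerPair_natDegree]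
      exact_mod_cast hi
    refine ⟨hmonic, by omega, fun k hk => ?_, fun k hk => ?_⟩
    · rw [heven k hN, hq _ (hS _ (by omega)), zero_div]
    · rw [hodd k hN, hq _ (hS _ (by omega)), zero_div]

/-- The `N`-th forward difference annihilates polynomials of degree `< N`. -/
theorem sum_neg_one_pow_choose_mul_eval {N : ℕ} {q : Polynomial ℝ} (hq : q.degree < N) :
    ∑ j ∈ Finset.range (N + 1), (-1 : ℝ) ^ (N - j) * N.choose j * q.eval (j : ℝ) = 0 := by
  rcases Nat.eq_zero_or_pos N with rfl | hN
  · have h0 : q = 0 := Polynomial.ext fun m =>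
      (Polynomial.degree_lt_iff_coeff_zero q 0).1 hq m (Nat.zero_le m)
    simp [h0]
  · have hq' : q.natDegree < N := by
      rcases eq_or_ne q 0 with rfl | h0
      · simpa
      · exact (Polynomial.natDegree_lt_iff_degree_lt h0).2 hq
    have h := congrFun (Polynomial.fwdDiff_iter_eq_zero_of_degree_lt hq') 0
    rw [fwdDiff_iter_eq_sum_shift] at h
    simpa using h

/-- A sequence on `{0, …, N}` orthogonal to all polynomials of degree `< N` is determined by its last
entry: test it against the Lagrange basis for the nodes `0, …, N - 1`. -/
theorem eq_of_sum_mul_eval_eq_zero {N : ℕ} {d e : ℕ → ℝ} (hN : d N = e N)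
    (hd : ∀ q : Polynomial ℝ, q.degree < N →
      ∑ j ∈ Finset.range (N + 1), d j * q.eval (j : ℝ) = 0)
    (he : ∀ q : Polynomial ℝ, q.degree < N →
      ∑ j ∈ Finset.range (N + 1), e j * q.eval (j : ℝ) = 0) {j : ℕ} (hj : j ≤ N) :
    d j = e j := by
  rcases hj.eq_or_lt with rfl | hj
  · exact hN
  have hinj : Set.InjOn (fun i : ℕ => (i : ℝ)) (Finset.range N) := Nat.cast_injective.injOn
  have hjm : j ∈ Finset.range N := Finset.mem_range.2 hj
  set q := Lagrange.basis (Finset.range N) (fun i : ℕ => (i : ℝ)) j with hqdef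
  have hdeg : q.degree < N := by
    rw [Lagrange.degree_basis hinj hjm, Finset.card_range]
    exact_mod_cast Nat.sub_lt (by omega) one_pos
  have key : ∀ c : ℕ → ℝ, ∑ i ∈ Finset.range (N + 1), c i * q.eval (i : ℝ) =
      c j + c N * q.eval (N : ℝ) := by
    intro c
    rw [Finset.sum_range_succ, Finset.sum_eq_single_of_mem j hjm]
    · have h1 : q.eval (j : ℝ) = 1 := Lagrange.eval_basis_self hinj hjm
      rw [h1, mul_one]
    · intro i hi hij
      have h0 : q.eval (i : ℝ) = 0 :=
        Lagrange.eval_basis_of_ne (v := fun i : ℕ => (i : ℝ)) hij.symm hi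
      rw [h0, mul_zero]
  have h1 := hd q hdeg
  have h2 := he q hdeg
  rw [key] at h1 h2
  rw [hN] at h1
  linarith

/-- The explicit multiple orthogonal polynomials: up to normalization,
`₁F₂(-N; α + 1, α + ν + 1; x)`. -/
theorem isBesselKMOP_iff_coeff {α ν : ℝ} (hα : -1 < α) (hαν : -1 < α + ν) (N : ℕ)
    (P : Polynomial ℝ) :
    IsBesselKMOP α ν ((N + 1) / 2) (N / 2) P ↔ P.natDegree ≤ N ∧ ∀ j ≤ N, P.coeff j =
      (-1) ^ (N - j) * N.choose j *
        (Real.Gamma (α + 1 + N) * Real.Gamma (α + ν + 1 + N) /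
          (Real.Gamma (α + 1 + j) * Real.Gamma (α + ν + 1 + j))) := by
  have hpos : ∀ j : ℕ, 0 < Real.Gamma (α + 1 + j) * Real.Gamma (α + ν + 1 + j) := fun j =>
    mul_pos (Real.Gamma_pos_of_pos (add_pos_of_pos_of_nonneg (by linarith) j.cast_nonneg))
      (Real.Gamma_pos_of_pos (add_pos_of_pos_of_nonneg (by linarith) j.cast_nonneg))
  rw [isBesselKMOP_iff hα hαν]
  -- The sequence `M_N (-1) ^ (N - j) (N choose j)` solves the system with last entry `M_N`.
  have hbin : ∀ q : Polynomial ℝ, q.degree < N → ∑ j ∈ Finset.range (N + 1),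
      (Real.Gamma (α + 1 + N) * Real.Gamma (α + ν + 1 + N) * ((-1) ^ (N - j) * N.choose j)) *
        q.eval (j : ℝ) = 0 := by
    intro q hq
    simp_rw [mul_assoc _ (_ * _) (q.eval _)]
    rw [← Finset.mul_sum, sum_neg_one_pow_choose_mul_eval hq, mul_zero]
  constructor
  · rintro ⟨hmonic, hdeg, horth⟩
    refine ⟨hdeg.le, fun j hj => ?_⟩
    have h := eq_of_sum_mul_eval_eq_zero (by
      have : P.coeff N = 1 := hdeg ▸ hmonic
      simp [this]) horth hbin hj
    have := (hpos j).ne'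
    rw [← mul_div_assoc, eq_div_iff this, h]
    ring
  · rintro ⟨hdeg, hcoeff⟩
    have hN : P.coeff N = 1 := by
      rw [hcoeff N le_rfl, div_self (hpos N).ne']
      simp
    refine ⟨Polynomial.monic_of_natDegree_le_of_coeff_eq_one N hdeg hN,
      le_antisymm hdeg (Polynomial.le_natDegree_of_ne_zero (by simp [hN])), fun q hq => ?_⟩
    rw [← hbin q hq]
    refine Finset.sum_congr rfl fun j hj => ?_
    rw [hcoeff j (Nat.lt_succ_iff.1 (Finset.mem_range.1 hj)), mul_assoc _ (_ / _),
      div_mul_cancel₀ _ (hpos j).ne']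
    ring

theorem existsUnique_isBesselKMOP {α ν : ℝ} (hα : -1 < α) (hαν : -1 < α + ν) (N : ℕ) :
    ∃! P : Polynomial ℝ, IsBesselKMOP α ν ((N + 1) / 2) (N / 2) P := by
  simp_rw [isBesselKMOP_iff_coeff hα hαν N]
  set c : ℕ → ℝ := fun j => (-1) ^ (N - j) * N.choose j *
        (Real.Gamma (α + 1 + N) * Real.Gamma (α + ν + 1 + N) /
          (Real.Gamma (α + 1 + j) * Real.Gamma (α + ν + 1 + j)))
  refine ⟨∑ j ∈ Finset.range (N + 1), Polynomial.monomial j (c j), ⟨?_, fun j hj => ?_⟩, ?_⟩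
  · exact Polynomial.natDegree_sum_le_of_forall_le _ _ fun j hj =>
      (Polynomial.natDegree_monomial_le _).trans (Nat.lt_succ_iff.1 (Finset.mem_range.1 hj))
  · simp [Polynomial.coeff_monomial, Nat.lt_succ_iff.2 hj, c]
  · rintro Q ⟨hdeg, hQ⟩
    rw [Q.as_sum_range' (N + 1) (Nat.lt_succ_iff.2 hdeg)]
    exact Finset.sum_congr rfl fun j hj => by
      rw [hQ j (Nat.lt_succ_iff.1 (Finset.mem_range.1 hj))]

/-! ### Convergence to the hypergeometric series -/

/-- A summation method with weights in `[0, 1]` tending to `1` termwise, applied to a power series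
that converges absolutely at radius `R`, converges uniformly on the closed disc: the error is at
most `∑ |1 - w n j| ‖c j‖ R ^ j`, which tends to `0` by dominated convergence. -/
theorem tendstoUniformlyOn_tsum_mul_of_tendsto_one {c : ℕ → ℂ} {w : ℕ → ℕ → ℝ} {R : ℝ}
    (hR : 0 ≤ R) (hc : Summable fun j => ‖c j‖ * R ^ j) (hw0 : ∀ n j, 0 ≤ w n j)
    (hw1 : ∀ n j, w n j ≤ 1)
    (hw : ∀ j, Filter.Tendsto (fun n => w n j) Filter.atTop (nhds 1)) :
    TendstoUniformlyOn (fun (n : ℕ) (z : ℂ) => ∑' j, (w n j : ℂ) * (c j * z ^ j))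
      (fun z => ∑' j, c j * z ^ j) Filter.atTop (Metric.closedBall 0 R) := by
  have hle : ∀ n j, |1 - w n j| ≤ 1 := fun n j =>
    abs_le.2 ⟨by linarith [hw1 n j], by linarith [hw0 n j]⟩
  have hsum : ∀ n, Summable fun j => |1 - w n j| * (‖c j‖ * R ^ j) := fun n =>
    hc.of_nonneg_of_le (fun j => by positivity) fun j =>
      mul_le_of_le_one_left (by positivity) (hle n j)
  have hzero : Filter.Tendsto (fun n => ∑' j, |1 - w n j| * (‖c j‖ * R ^ j)) Filter.atTop
      (nhds 0) := by
    have h := tendsto_tsum_of_dominated_convergence (𝓕 := Filter.atTop)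
      (f := fun n j => |1 - w n j| * (‖c j‖ * R ^ j)) (g := fun _ => 0) hc (fun j => by
        simpa using (((tendsto_const_nhds (x := (1 : ℝ))).sub (hw j)).abs).mul_const (‖c j‖ * R ^ j))
      (Filter.Eventually.of_forall fun n j => by
        rw [Real.norm_of_nonneg (by positivity)]
        exact mul_le_of_le_one_left (by positivity) (hle n j))
    simpa using h
  rw [Metric.tendstoUniformlyOn_iff]
  intro ε hε
  filter_upwards [hzero.eventually_lt_const hε] with n hn z hz
  refine lt_of_le_of_lt ?_ hn
  have hz : ‖z‖ ≤ R := by simpa using hz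
  have hterm : ∀ j, ‖c j * z ^ j‖ ≤ ‖c j‖ * R ^ j := fun j => by
    rw [norm_mul, norm_pow]
    gcongr
  have hs1 : Summable fun j => c j * z ^ j := .of_norm_bounded hc hterm
  have hs2 : Summable fun j => (w n j : ℂ) * (c j * z ^ j) := by
    refine .of_norm_bounded hc fun j => ?_
    rw [norm_mul, Complex.norm_of_nonneg (hw0 n j)]
    exact (mul_le_of_le_one_left (norm_nonneg _) (hw1 n j)).trans (hterm j)
  rw [dist_eq_norm, ← hs1.tsum_sub hs2]
  refine tsum_of_norm_bounded (hsum n).hasSum fun j => ?_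
  rw [show c j * z ^ j - (w n j : ℂ) * (c j * z ^ j) = ((1 - w n j : ℝ) : ℂ) * (c j * z ^ j) by
    push_cast; ring, norm_mul, Complex.norm_real, Real.norm_eq_abs]
  exact mul_le_mul_of_nonneg_left (hterm j) (abs_nonneg _)

theorem pochhammerSymbol_ofReal (a : ℝ) (k : ℕ) :
    pochhammerSymbol (a : ℂ) k = ((ascPochhammer ℝ k).eval a : ℝ) := by
  rw [pochhammerSymbol, ← ascPochhammer_map (algebraMap ℝ ℂ), Polynomial.eval_map_algebraMap]
  exact Polynomial.aeval_algebraMap_apply_eq_algebraMap_eval a _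

/-- A lower bound for `(a)_k` independent of `k`, so that the factor `1 / k!` alone gives the
convergence of the `₀F₂` series. -/
theorem min_le_ascPochhammer_eval {a : ℝ} (ha : 0 < a) (k : ℕ) :
    min a 1 ≤ (ascPochhammer ℝ k).eval a := by
  have h : ∀ k : ℕ, a ≤ (ascPochhammer ℝ (k + 1)).eval a := by
    intro k
    induction k with
    | zero => simp
    | succ k ih =>
      rw [ascPochhammer_succ_eval]
      push_cast
      nlinarith [mul_nonneg (ha.le.trans ih) (show (0 : ℝ) ≤ a + k by positivity)]
  rcases k with _ | k
  · simp
  · exact (min_le_left _ _).trans (h k)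

theorem summable_pow_div_ascPochhammer {a b : ℝ} (ha : 0 < a) (hb : 0 < b) {R : ℝ} (hR : 0 ≤ R) :
    Summable fun k : ℕ => R ^ k /
      ((ascPochhammer ℝ k).eval a * (ascPochhammer ℝ k).eval b * (k.factorial : ℝ)) := by
  refine ((Real.summable_pow_div_factorial R).mul_left (min a 1 * min b 1)⁻¹).of_nonneg_of_le
    (fun k => ?_) fun k => ?_
  · have := ascPochhammer_pos k a ha
    have := ascPochhammer_pos k b hb
    positivity
  · have hm : 0 < min a 1 * min b 1 := by positivity
    rw [inv_mul_eq_div, div_div, mul_comm (k.factorial : ℝ)]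
    have := min_le_ascPochhammer_eval ha k
    have := min_le_ascPochhammer_eval hb k
    have := ascPochhammer_pos k a ha
    gcongr

theorem tendsto_descFactorial_div_pow (j : ℕ) :
    Filter.Tendsto (fun n : ℕ => (n.descFactorial j : ℝ) / (n : ℝ) ^ j) Filter.atTop (nhds 1) := by
  refine (Asymptotics.isEquivalent_iff_tendsto_one ?_).1 (isEquivalent_descFactorial j)
  filter_upwards [Filter.eventually_ne_atTop 0] with n hn
  positivity

/-- The normalized and rescaled polynomial is the `₀F₂` series at `-z` with its `j`-th term damped by
`N (N-1) ⋯ (N-j+1) / N ^ j`. This factor vanishes for `j > N`, which turns the finite sum into a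
series. -/
theorem rescaled_isBesselKMOP_eq_tsum {α ν : ℝ} (hα : -1 < α) (hαν : -1 < α + ν) {N : ℕ}
    {P : Polynomial ℝ} (hP : IsBesselKMOP α ν ((N + 1) / 2) (N / 2) P) (z : ℂ) :
    (-1 : ℂ) ^ N * (Polynomial.aeval (z / (N : ℂ)) P /
      (pochhammerSymbol ((α : ℂ) + 1) N * pochhammerSymbol ((α : ℂ) + (ν : ℂ) + 1) N)) =
    ∑' j : ℕ, (((N.descFactorial j : ℝ) / (N : ℝ) ^ j : ℝ) : ℂ) *
      ((-1) ^ j / (pochhammerSymbol ((α : ℂ) + 1) j * pochhammerSymbol ((α : ℂ) + (ν : ℂ) + 1) j *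
        (j.factorial : ℂ)) * z ^ j) := by
  have ha : 0 < α + 1 := by linarith
  have hb : 0 < α + ν + 1 := by linarith
  obtain ⟨hdeg, hcoeff⟩ := (isBesselKMOP_iff_coeff hα hαν N P).1 hP
  rw [tsum_eq_sum (s := Finset.range (N + 1)) fun j hj => by
      rw [Nat.descFactorial_eq_zero_iff_lt.2 (by simpa using hj)]
      simp,
    Polynomial.aeval_eq_sum_range' (Nat.lt_succ_iff.2 hdeg), Finset.sum_div, Finset.mul_sum]
  refine Finset.sum_congr rfl fun j hj => ?_
  have hj : j ≤ N := Nat.lt_succ_iff.1 (Finset.mem_range.1 hj)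
  rw [hcoeff j hj, show (α : ℂ) + 1 = ((α + 1 : ℝ) : ℂ) by push_cast; rfl,
    show (α : ℂ) + ν + 1 = ((α + ν + 1 : ℝ) : ℂ) by push_cast; rfl]
  simp only [pochhammerSymbol_ofReal, Gamma_add_nat ha, Gamma_add_nat hb, Complex.real_smul]
  have hA : ∀ k, (((ascPochhammer ℝ k).eval (α + 1) : ℝ) : ℂ) ≠ 0 := fun k =>
    Complex.ofReal_ne_zero.2 (ascPochhammer_pos k _ ha).ne'
  have hB : ∀ k, (((ascPochhammer ℝ k).eval (α + ν + 1) : ℝ) : ℂ) ≠ 0 := fun k =>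
    Complex.ofReal_ne_zero.2 (ascPochhammer_pos k _ hb).ne'
  have hGa : (Real.Gamma (α + 1) : ℂ) ≠ 0 :=
    Complex.ofReal_ne_zero.2 (Real.Gamma_pos_of_pos ha).ne'
  have hGb : (Real.Gamma (α + ν + 1) : ℂ) ≠ 0 :=
    Complex.ofReal_ne_zero.2 (Real.Gamma_pos_of_pos hb).ne'
  have hsign : (-1 : ℂ) ^ N * (-1) ^ (N - j) = (-1) ^ j := by
    obtain ⟨m, rfl⟩ := Nat.exists_eq_add_of_le hj
    rw [Nat.add_sub_cancel_left, pow_add, mul_assoc, ← pow_add, ← two_mul, pow_mul]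
    simp
  have hf : (j.factorial : ℂ) ≠ 0 := Nat.cast_ne_zero.2 j.factorial_ne_zero
  have hAN := hA N
  have hAj := hA j
  have hBN := hB N
  have hBj := hB j
  rw [← hsign, Nat.descFactorial_eq_factorial_mul_choose, div_pow]
  push_cast
  set x := ((N : ℂ) ^ j)
  -- Both sides carry the factor `1 / N ^ j`, so they agree also for `N = 0`, where it may be `0`.
  rcases eq_or_ne x 0 with hx | hx
  · simp [hx]
  · field_simp

theorem theorem5 (α ν : ℝ) (hα : -1 < α) (hαν : -1 < α + ν) :
    (∀ n : ℕ, (∃! Q : Polynomial ℝ, IsBesselKMOP α ν n n Q) ∧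
      (∃! Q : Polynomial ℝ, IsBesselKMOP α ν (n + 1) n Q)) ∧
    ∀ (P : ℕ → ℕ → Polynomial ℝ) (p : ℕ → Polynomial ℝ),
      (∀ n : ℕ, IsBesselKMOP α ν n n (P n n)) →
      (∀ n : ℕ, IsBesselKMOP α ν (n + 1) n (P (n + 1) n)) →
      (∀ n : ℕ, p (2 * n) = P n n) →
      (∀ n : ℕ, p (2 * n + 1) = P (n + 1) n) →
      ∀ K : Set ℂ, IsCompact K →
        TendstoUniformlyOn
          (fun (n : ℕ) (z : ℂ) =>
            (-1 : ℂ) ^ n * (Polynomial.aeval (z / (n : ℂ)) (p n) /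
              (pochhammerSymbol ((α : ℂ) + 1) n * pochhammerSymbol ((α : ℂ) + (ν : ℂ) + 1) n)))
          (fun z : ℂ => hypergeometric0F2 ((α : ℂ) + 1) ((α : ℂ) + (ν : ℂ) + 1) (-z))
          Filter.atTop K := by
  have heven : ∀ n : ℕ, (2 * n + 1) / 2 = n ∧ 2 * n / 2 = n := fun n => by omega
  have hodd : ∀ n : ℕ, (2 * n + 1 + 1) / 2 = n + 1 ∧ (2 * n + 1) / 2 = n := fun n => by omega
  refine ⟨fun n => ⟨?_, ?_⟩, fun P p hP0 hP1 hp0 hp1 K hK => ?_⟩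
  · simpa only [heven n] using existsUnique_isBesselKMOP hα hαν (2 * n)
  · simpa only [hodd n] using existsUnique_isBesselKMOP hα hαν (2 * n + 1)
  have hp : ∀ N : ℕ, IsBesselKMOP α ν ((N + 1) / 2) (N / 2) (p N) := by
    intro N
    obtain ⟨k, rfl | rfl⟩ := Nat.even_or_odd' N
    · rw [(heven k).1, (heven k).2, hp0]
      exact hP0 k
    · rw [(hodd k).1, (hodd k).2, hp1]
      exact hP1 k
  have ha : 0 < α + 1 := by linarith
  have hb : 0 < α + ν + 1 := by linarith
  obtain ⟨R, hR, hKR⟩ := hK.isBounded.subset_closedBall_lt 0 0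
  have hc : Summable fun j : ℕ => ‖(-1 : ℂ) ^ j / (pochhammerSymbol ((α : ℂ) + 1) j *
      pochhammerSymbol ((α : ℂ) + (ν : ℂ) + 1) j * (j.factorial : ℂ))‖ * R ^ j := by
    refine (summable_pow_div_ascPochhammer ha hb hR.le).congr fun j => ?_
    rw [show (α : ℂ) + 1 = ((α + 1 : ℝ) : ℂ) by push_cast; rfl,
      show (α : ℂ) + ν + 1 = ((α + ν + 1 : ℝ) : ℂ) by push_cast; rfl,
      pochhammerSymbol_ofReal, pochhammerSymbol_ofReal, norm_div, norm_mul, norm_mul,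
      Complex.norm_of_nonneg (ascPochhammer_pos j _ ha).le,
      Complex.norm_of_nonneg (ascPochhammer_pos j _ hb).le, norm_pow, norm_neg, norm_one, one_pow,
      Complex.norm_natCast]
    ring
  have hlim := (tendstoUniformlyOn_tsum_mul_of_tendsto_one hR.le hc
    (w := fun n j => (n.descFactorial j : ℝ) / (n : ℝ) ^ j) (fun n j => by positivity)
    (fun n j => div_le_one_of_le₀ (by exact_mod_cast Nat.descFactorial_le_pow n j)
      (by positivity)) tendsto_descFactorial_div_pow).mono hKR
  refine (hlim.congr (Filter.Eventually.of_forall fun N z _ =>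
    (rescaled_isBesselKMOP_eq_tsum hα hαν (hp N) z).symm)).congr_right fun z _ => ?_
  refine tsum_congr fun j => ?_
  rw [neg_pow z]
  ring
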